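/- Let $\mathbb{K}$ be a field of characteristic $0$, let $l\ge 1$, $S=\mathbb{K}[x_1,\dots,x_l]$ and $\bar S=\mathbb{K}[x_1,\dots,x_{l-1}]$, both with the standard grading. Let $I\subseteq S$ be a strongly stable ideal, i.e. a monomial ideal such that for every power-product $t\in I$ and all $1\le i<j\le l$ with $x_j\mid t$, also $x_i t/x_j\in I$; put $\bar I=I\cap\bar S$. Assume that $S/I$ has the weak Lefschetz property, i.e. there is $\ell\in(S/I)_1$ such that for every $i\ge 0$ the multiplication map $\times\ell\colon(S/I)_i\to(S/I)_{i+1}$ has full rank (is injective or surjective). Let $\mathrm{HF}(S/I,j)=\dim_{\mathbb{K}}(S/I)_j$, with $\mathrm{HF}(S/I,-1)=0$, and $c_j(S/I)=\max\{\mathrm{HF}(S/I,j-1)-\mathrm{HF}(S/I,j),\,0\}$. Let $\beta_{i,d}(S/I)=\dim_{\mathbb{K}}\mathrm{Tor}^S_i(S/I,\mathbb{K})_d$ and $\beta_{i,d}(\bar S/\bar I)=\dim_{\mathbb{K}}\mathrm{Tor}^{\bar S}_i(\bar S/\bar I,\mathbb{K})_d$ be the graded Betti numbers. Then for all $i,j\ge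 0$ $$\beta_{i,i+j}(S/I)=\beta_{i,i+j}(\bar S/\bar I)+\binom{l-1}{i-1}\,c_{j+1}(S/I),$$ where $\binom{l-1}{-1}=0$. -/

import Mathlib

open MvPolynomial

noncomputable section

namespace LefschetzBetti

/-! ### Strongly stable ideals -/

/-- A monomial ideal: an ideal generated by power-products. -/
def IsMonomialIdeal {K : Type*} [Field K] {l : ℕ} (I : Ideal (MvPolynomial (Fin l) K)) : Prop :=
  ∃ A : Set (Fin l →₀ ℕ), I = Ideal.span ((fun t => monomial t (1 : K)) '' A)

/-- A strongly stable ideal: a monomial ideal such that, for every power-product `x ^ t` in it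
and all `i < j` with `x_j ∣ x ^ t`, the power-product `x_i * x ^ t / x_j` is in it too. -/
def IsStronglyStable {K : Type*} [Field K] {l : ℕ} (I : Ideal (MvPolynomial (Fin l) K)) : Prop :=
  IsMonomialIdeal I ∧
    ∀ t : Fin l →₀ ℕ, monomial t (1 : K) ∈ I → ∀ i j : Fin l, i < j → t j ≠ 0 →
      monomial (t - Finsupp.single j 1 + Finsupp.single i 1) (1 : K) ∈ I

/-! ### The weak Lefschetz property and the Hilbert function -/

/-- The weak Lefschetz property of a graded algebra `R = ⨁ 𝒜 i` with finite-dimensional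
components: for some `a` in `𝒜 1` every multiplication map `𝒜 i → 𝒜 (i + 1)` by `a` has full
rank, that is, it is injective or surjective. -/
def HasWLP {K R : Type*} [Field K] [CommRing R] [Algebra K R] (𝒜 : ℕ → Submodule K R) : Prop :=
  ∃ a ∈ 𝒜 1, ∀ i : ℕ,
    (∀ f ∈ 𝒜 i, a * f = 0 → f = 0) ∨ (∀ g ∈ 𝒜 (i + 1), ∃ f ∈ 𝒜 i, a * f = g)

/-- The homogeneous component `(S/I)_j` of the quotient of the polynomial ring by an ideal. -/
def quotPiece {K : Type*} [Field K] {l : ℕ} (I : Ideal (MvPolynomial (Fin l) K)) (j : ℕ) :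
    Submodule K (MvPolynomial (Fin l) K ⧸ I) :=
  (homogeneousSubmodule (Fin l) K j).map (Ideal.Quotient.mkₐ K I).toLinearMap

/-- The Hilbert function `HF(S/I, j) = dim_K (S/I)_j`. -/
def hilbertFn {K : Type*} [Field K] {l : ℕ} (I : Ideal (MvPolynomial (Fin l) K)) (j : ℕ) : ℕ :=
  Module.finrank K (quotPiece I j)

/-- `c_j(S/I) = max {HF(S/I, j - 1) - HF(S/I, j), 0}`, where `HF(S/I, -1) = 0`. -/
def cDiff {K : Type*} [Field K] {l : ℕ} (I : Ideal (MvPolynomial (Fin l) K)) : ℕ → ℤ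
  | 0 => max (0 - (hilbertFn I 0 : ℤ)) 0
  | j + 1 => max ((hilbertFn I j : ℤ) - (hilbertFn I (j + 1) : ℤ)) 0

/-! ### Graded Betti numbers

Let `S = K[x_1, …, x_l]` and let `M = ⨁ 𝓜 j` be a graded `S`-module. Its graded Betti numbers are
`β_{i,d}(M) = dim_K Tor_i^S(M, K)_d`. Here `Tor` is computed by tensoring `M` with the graded free
resolution of `K` by the Koszul complex, whose `i`-th term `⋀^i S(-1)^l` has the basis
`e_s = e_{k_1} ∧ … ∧ e_{k_i}`, `s = {k_1 < … < k_i}`, in degree `i`, and whose differential is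
`e_s ↦ ∑_r (-1)^(r-1) x_{k_r} e_{s \ {k_r}}`. A chain `∑_s c(s) e_s` of `M ⊗ ⋀ S(-1)^l` is
written as the function `c`. -/

section Koszul

variable {K : Type*} [Field K] {l : ℕ} {M : Type*} [AddCommGroup M] [Module K M]
  [Module (MvPolynomial (Fin l) K) M] [IsScalarTower K (MvPolynomial (Fin l) K) M]

/-- The coefficient with which `e_{t ∪ {k}}`, for `k ∉ t`, contributes to `e_t` under the
differential: `± x_k`, the sign being given by the position of `k` in `t ∪ {k}`. -/
def koszulCoeff (K : Type*) [Field K] {l : ℕ} (k : Fin l) (t : Finset (Fin l)) :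
    MvPolynomial (Fin l) K :=
  (-1) ^ (t.filter (· < k)).card * X k

variable (K M) in
/-- The differential of the Koszul complex of `x_1, …, x_l` with coefficients in `M`, in all
homological degrees at once. -/
def koszulD : (Finset (Fin l) → M) →ₗ[K] (Finset (Fin l) → M) where
  toFun c t := ∑ k ∈ tᶜ, koszulCoeff K k t • c (insert k t)
  map_add' c c' := by
    funext t
    simp [smul_add, Finset.sum_add_distrib]
  map_smul' a c := by
    funext t
    simp only [Pi.smul_apply, RingHom.id_apply, Finset.smul_sum]
    exact Finset.sum_congr rfl fun k _ => smul_algebra_smul_comm a _ _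

/-- The chains of homological degree `i` and internal degree `d`: combinations of the `e_s` with
`s` of size `i`, with coefficients in the component of degree `d - i` (none if `d < i`). -/
def koszulPiece (𝓜 : ℕ → Submodule K M) (i d : ℕ) : Submodule K (Finset (Fin l) → M) :=
  Submodule.pi Set.univ fun s => if s.card = i ∧ i ≤ d then 𝓜 (d - i) else ⊥

/-- The cycles of homological degree `i` and internal degree `d`. -/
def koszulCycles (𝓜 : ℕ → Submodule K M) (i d : ℕ) : Submodule K (Finset (Fin l) → M) :=
  koszulPiece 𝓜 i d ⊓ LinearMap.ker (koszulD K M)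

/-- The boundaries of homological degree `i` and internal degree `d`. -/
def koszulBoundaries (𝓜 : ℕ → Submodule K M) (i d : ℕ) : Submodule K (Finset (Fin l) → M) :=
  (koszulPiece 𝓜 (i + 1) d).map (koszulD K M)

/-- `Tor_i^S(M, K)_d`, as the homology of `M ⊗ ⋀ S(-1)^l` in homological degree `i` and internal
degree `d`. -/
abbrev gradedTor (𝓜 : ℕ → Submodule K M) (i d : ℕ) : Type _ :=
  koszulCycles (l := l) 𝓜 i d ⧸ (koszulBoundaries 𝓜 i d).submoduleOf (koszulCycles 𝓜 i d)

theorem koszulCoeff_antisymm (t : Finset (Fin l)) (k m : Fin l) (hk : k ∉ t) (hm : m ∉ t)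
    (h : k ≠ m) :
    koszulCoeff K k t * koszulCoeff K m (insert k t)
      = - (koszulCoeff K m t * koszulCoeff K k (insert m t)) := by
  unfold koszulCoeff
  rw [Finset.filter_insert, Finset.filter_insert]
  rcases lt_or_gt_of_ne h with h | h
  · rw [if_pos h, if_neg (not_lt_of_gt h), Finset.card_insert_of_notMem (by simp [hk])]
    ring
  · rw [if_neg (not_lt_of_gt h), if_pos h, Finset.card_insert_of_notMem (by simp [hm])]
    ring

theorem koszulD_koszulD (c : Finset (Fin l) → M) : koszulD K M (koszulD K M c) = 0 := by
  funext t
  simp only [koszulD, LinearMap.coe_mk, AddHom.coe_mk, Finset.smul_sum, Pi.zero_apply, smul_smul]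
  rw [Finset.sum_sigma']
  refine Finset.sum_involution (fun p _ => ⟨p.2, p.1⟩) ?_ ?_ ?_ ?_
  · rintro ⟨k, m⟩ h
    simp only [Finset.mem_sigma, Finset.mem_compl, Finset.mem_insert, not_or] at h
    rw [koszulCoeff_antisymm t k m h.1 h.2.2 (Ne.symm h.2.1), Finset.insert_comm, neg_smul,
      neg_add_cancel]
  · rintro ⟨k, m⟩ h _ h'
    simp only [Finset.mem_sigma, Finset.mem_compl, Finset.mem_insert, not_or] at h
    simp only [Sigma.mk.injEq] at h'
    exact h.2.1 h'.1
  · rintro ⟨k, m⟩ h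
    simp only [Finset.mem_sigma, Finset.mem_compl, Finset.mem_insert, not_or] at h ⊢
    exact ⟨h.2.2, Ne.symm h.2.1, h.1⟩
  · rintro ⟨k, m⟩ _
    rfl

/-- Boundaries are cycles. -/
theorem koszulBoundaries_le_koszulCycles (𝓜 : ℕ → Submodule K M)
    (h𝓜 : ∀ (k : Fin l) (j : ℕ), ∀ f ∈ 𝓜 j, (X k : MvPolynomial (Fin l) K) • f ∈ 𝓜 (j + 1))
    (i d : ℕ) : koszulBoundaries (l := l) 𝓜 i d ≤ koszulCycles 𝓜 i d := by
  rintro _ ⟨c, hc, rfl⟩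
  refine ⟨?_, by simpa using koszulD_koszulD c⟩
  simp only [koszulPiece, SetLike.mem_coe, Submodule.mem_pi, Set.mem_univ, true_imp_iff] at hc ⊢
  intro t
  refine Submodule.sum_mem _ fun k hk => ?_
  have h := hc (insert k t)
  rw [Finset.card_insert_of_notMem (by simpa using hk)] at h
  by_cases ht : t.card = i
  · by_cases hd : i + 1 ≤ d
    · rw [if_pos ⟨by omega, hd⟩] at h
      rw [if_pos ⟨ht, by omega⟩]
      have h2 := h𝓜 k _ _ h
      rw [show d - (i + 1) + 1 = d - i by omega] at h2
      unfold koszulCoeff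
      rw [mul_smul]
      rcases neg_one_pow_eq_or (MvPolynomial (Fin l) K) (t.filter (· < k)).card with e | e <;>
        rw [e]
      · simpa using h2
      · simpa using h2
    · rw [if_neg (by omega), Submodule.mem_bot] at h
      rw [h, smul_zero]
      exact zero_mem _
  · rw [if_neg (by omega), Submodule.mem_bot] at h
    rw [h, smul_zero]
    exact zero_mem _

end Koszul

/-- The graded Betti number `β_{i,d}(S/I) = dim_K Tor_i^S(S/I, K)_d`, where `S` is the polynomial
ring of which `I` is an ideal. -/
def gradedBetti {K : Type*} [Field K] {l : ℕ} (I : Ideal (MvPolynomial (Fin l) K)) (i d : ℕ) : ℕ :=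
  Module.finrank K (gradedTor (l := l) (quotPiece I) i d)

/-- The contraction `Ī = I ∩ K[x_1, …, x_{l-1}]`, here with `l = n + 1`: the polynomial ring in
the first `n` variables is embedded by sending its variables to the first `n` variables. -/
def contractLast {K : Type*} [Field K] {n : ℕ} (I : Ideal (MvPolynomial (Fin (n + 1)) K)) :
    Ideal (MvPolynomial (Fin n) K) :=
  I.comap (rename (R := K) (Fin.castSucc : Fin n → Fin (n + 1)))

end LefschetzBetti

end

/-! Write `A = S/I`, `B = S̄/Ī` and `x` for the last variable. Since `I` is monomial, setting `x =
0` gives a retraction `A → B` with kernel `xA`, so `A = B ⊕ xA`. Strong stability adds that an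
element of `A` killed by `x` is killed by every variable.

Split a Koszul chain over `A` into its part `c₀` on sets without the last index and its part `c₁` on
sets with it; the Koszul complex is then the mapping cone of `±x` on the complex in the first `n`
variables. Modulo boundaries `c₀` may be taken with values in `B`. The cycle condition `d c₀ ± x c₁
= 0` then splits along `B ⊕ xA`: `c₀` is a cycle over `B` and `x c₁ = 0`, so every variable kills
`c₁` and no further condition remains. Thus in degree `i + j` the `i`-th Tor of `A` is that of `B`
plus one copy of `(0 :_A x)_j` for each set of size `i - 1`
(`exists_sub_chainIncl_mem_koszulBoundaries` for surjectivity, `of_chainIncl_mem_koszulBoundaries`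
for injectivity).

The weak Lefschetz property enters only to compute `dim (0 :_A x)_j = c_{j+1}`
(`finrank_lastKernel`): the kernel of `x` lies in that of every linear form, so `x` has full rank as
soon as some linear form does. -/

noncomputable section

namespace LefschetzBetti

/-! ### Setting the last variable to zero -/

section Quotients

variable {K : Type*} [Field K] {n : ℕ}

/-- The retraction `S → S̄` with kernel generated by the last variable. -/
def evalLast (K : Type*) [Field K] (n : ℕ) :
    MvPolynomial (Fin (n + 1)) K →ₐ[K] MvPolynomial (Fin n) K :=
  aeval (Fin.lastCases 0 X)

@[simp] theorem evalLast_X_last : evalLast K n (X (Fin.last n)) = 0 := by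
  simp [evalLast]

@[simp] theorem evalLast_X_castSucc (k : Fin n) : evalLast K n (X k.castSucc) = X k := by
  simp [evalLast]

@[simp] theorem evalLast_rename (p : MvPolynomial (Fin n) K) :
    evalLast K n (rename Fin.castSucc p) = p := by
  have : (evalLast K n).comp (rename Fin.castSucc) = AlgHom.id K _ := by
    ext k
    simp
  exact DFunLike.congr_fun this p

theorem X_last_dvd_sub_rename_evalLast (p : MvPolynomial (Fin (n + 1)) K) :
    (X (Fin.last n) : MvPolynomial (Fin (n + 1)) K) ∣
      p - rename Fin.castSucc (evalLast K n p) := by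
  rw [← Ideal.mem_span_singleton, ← Ideal.Quotient.eq]
  have : (Ideal.Quotient.mkₐ K (Ideal.span {(X (Fin.last n) : MvPolynomial (Fin (n + 1)) K)})) =
      (Ideal.Quotient.mkₐ K _).comp ((rename Fin.castSucc).comp (evalLast K n)) := by
    ext k
    induction k using Fin.lastCases with
    | last => simp
    | cast k => simp
  exact DFunLike.congr_fun this p

theorem evalLast_isHomogeneous {p : MvPolynomial (Fin (n + 1)) K} {j : ℕ}
    (hp : p.IsHomogeneous j) : (evalLast K n p).IsHomogeneous j := by
  have := hp.aeval (n := 1) (Fin.lastCases 0 X : Fin (n + 1) → MvPolynomial (Fin n) K) (fun k => by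
    induction k using Fin.lastCases with
    | last => simpa using isHomogeneous_zero _ _ _
    | cast k => simpa using isHomogeneous_X _ _)
  simpa [evalLast] using this

theorem mem_contractLast {I : Ideal (MvPolynomial (Fin (n + 1)) K)}
    {p : MvPolynomial (Fin n) K} : p ∈ contractLast I ↔ rename Fin.castSucc p ∈ I :=
  Iff.rfl

theorem IsMonomialIdeal.mem_iff {l : ℕ} {I : Ideal (MvPolynomial (Fin l) K)}
    (hI : IsMonomialIdeal I) {p : MvPolynomial (Fin l) K} :
    p ∈ I ↔ ∀ t ∈ p.support, monomial t (1 : K) ∈ I := by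
  obtain ⟨A, rfl⟩ := hI
  rw [mem_ideal_span_monomial_image]
  refine forall₂_congr fun t _ => ?_
  classical
  rw [mem_ideal_span_monomial_image, support_monomial, if_neg one_ne_zero]
  simp

theorem monomial_mem_of_X_mul_mem {l : ℕ} {I : Ideal (MvPolynomial (Fin l) K)}
    (hI : IsMonomialIdeal I) {p : MvPolynomial (Fin l) K} {k : Fin l} (hp : X k * p ∈ I)
    {t : Fin l →₀ ℕ} (ht : t ∈ p.support) :
    monomial (Finsupp.single k 1 + t) (1 : K) ∈ I := by
  refine hI.mem_iff.1 hp _ ?_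
  rw [mem_support_iff, coeff_X_mul]
  exact mem_support_iff.1 ht

/-- In a quotient by a strongly stable ideal, what is killed by the last variable is killed by
all variables. -/
theorem IsStronglyStable.X_mul_mem {I : Ideal (MvPolynomial (Fin (n + 1)) K)}
    (hI : IsStronglyStable I) {p : MvPolynomial (Fin (n + 1)) K} (hp : X (Fin.last n) * p ∈ I)
    (k : Fin (n + 1)) : X k * p ∈ I := by
  rcases eq_or_ne k (Fin.last n) with rfl | hk
  · exact hp
  rw [hI.1.mem_iff]
  intro u hu
  rw [support_X_mul, Finset.mem_map] at hu
  obtain ⟨t, ht, rfl⟩ := hu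
  -- Strong stability trades the factor `x_l` of `x_l * x ^ t` for `x_k`, which gives `x_k * x ^ t`.
  have h := hI.2 _ (monomial_mem_of_X_mul_mem hI.1 hp ht) k (Fin.last n) (Fin.lt_last_iff_ne_last.2 hk)
    (by simp)
  rw [add_tsub_cancel_left, add_comm t] at h
  exact h

/-- A power-product free of the last variable is kept, and any other is sent to zero. This is what
lets the retraction descend to the quotients. -/
theorem le_comap_evalLast {I : Ideal (MvPolynomial (Fin (n + 1)) K)} (hI : IsMonomialIdeal I) :
    I ≤ (contractLast I).comap (evalLast K n) := by
  intro p hp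
  rw [p.as_sum]
  refine Ideal.sum_mem _ fun t ht => ?_
  have h := hI.mem_iff.1 hp t ht
  rw [← mul_one (coeff t p), ← C_mul_monomial]
  refine Ideal.mul_mem_left _ _ ?_
  rw [Ideal.mem_comap, mem_contractLast]
  by_cases h0 : t (Fin.last n) = 0
  · convert h using 1
    rw [evalLast, aeval_monomial, map_mul, monomial_eq, map_one, map_one, map_one, one_mul, one_mul,
      Finsupp.prod_fintype _ _ (by simp), Finsupp.prod_fintype _ _ (by simp), map_prod,
      Fin.prod_univ_castSucc, Fin.prod_univ_castSucc]
    simp [h0]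
  · convert zero_mem I using 1
    rw [evalLast, aeval_monomial, Finsupp.prod_fintype _ _ (by simp), Fin.prod_univ_castSucc]
    simp [h0]

/-- The inclusion of `S̄/Ī` into `S/I`. -/
def quotIncl (I : Ideal (MvPolynomial (Fin (n + 1)) K)) :
    (MvPolynomial (Fin n) K ⧸ contractLast I) →ₐ[K] (MvPolynomial (Fin (n + 1)) K ⧸ I) :=
  Ideal.quotientMapₐ I (rename Fin.castSucc) le_rfl

/-- The retraction of `S/I` onto `S̄/Ī`. -/
def quotRetr (I : Ideal (MvPolynomial (Fin (n + 1)) K)) (hI : IsMonomialIdeal I) :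
    (MvPolynomial (Fin (n + 1)) K ⧸ I) →ₐ[K] (MvPolynomial (Fin n) K ⧸ contractLast I) :=
  Ideal.quotientMapₐ _ (evalLast K n) (le_comap_evalLast hI)

variable {I : Ideal (MvPolynomial (Fin (n + 1)) K)}

@[simp] theorem quotIncl_mk (p : MvPolynomial (Fin n) K) :
    quotIncl I (Ideal.Quotient.mk _ p) = Ideal.Quotient.mk I (rename Fin.castSucc p) := rfl

@[simp] theorem quotRetr_mk (hI : IsMonomialIdeal I) (p : MvPolynomial (Fin (n + 1)) K) :
    quotRetr I hI (Ideal.Quotient.mk _ p) = Ideal.Quotient.mk _ (evalLast K n p) := rfl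

@[simp] theorem quotRetr_quotIncl (hI : IsMonomialIdeal I)
    (f : MvPolynomial (Fin n) K ⧸ contractLast I) : quotRetr I hI (quotIncl I f) = f := by
  obtain ⟨p, rfl⟩ := Ideal.Quotient.mk_surjective f
  simp

theorem mem_quotPiece {l : ℕ} {I : Ideal (MvPolynomial (Fin l) K)} {j : ℕ}
    {f : MvPolynomial (Fin l) K ⧸ I} :
    f ∈ quotPiece I j ↔ ∃ p : MvPolynomial (Fin l) K, p.IsHomogeneous j ∧
      Ideal.Quotient.mk I p = f := Iff.rfl

theorem quotIncl_mem_quotPiece {j : ℕ} {f : MvPolynomial (Fin n) K ⧸ contractLast I}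
    (hf : f ∈ quotPiece (contractLast I) j) : quotIncl I f ∈ quotPiece I j := by
  obtain ⟨p, hp, rfl⟩ := mem_quotPiece.1 hf
  exact ⟨_, hp.rename_isHomogeneous, rfl⟩

theorem quotRetr_mem_quotPiece (hI : IsMonomialIdeal I) {j : ℕ}
    {f : MvPolynomial (Fin (n + 1)) K ⧸ I} (hf : f ∈ quotPiece I j) :
    quotRetr I hI f ∈ quotPiece (contractLast I) j := by
  obtain ⟨p, hp, rfl⟩ := mem_quotPiece.1 hf
  exact ⟨_, evalLast_isHomogeneous hp, rfl⟩

theorem X_mul_mem_quotPiece {l : ℕ} {I : Ideal (MvPolynomial (Fin l) K)} (k : Fin l) {j : ℕ}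
    {f : MvPolynomial (Fin l) K ⧸ I} (hf : f ∈ quotPiece I j) :
    Ideal.Quotient.mk I (X k) * f ∈ quotPiece I (j + 1) := by
  obtain ⟨p, hp, rfl⟩ := mem_quotPiece.1 hf
  exact ⟨X k * p, by rw [add_comm]; exact (isHomogeneous_X K k).mul hp,
    map_mul (Ideal.Quotient.mk I) _ _⟩

/-- `S/I` is the direct sum of `S̄/Ī` and the multiples of the last variable, in each degree. -/
theorem exists_eq_quotIncl_quotRetr_add (hI : IsMonomialIdeal I) {j : ℕ}
    {f : MvPolynomial (Fin (n + 1)) K ⧸ I} (hf : f ∈ quotPiece I j) :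
    ∃ e ∈ (if 1 ≤ j then quotPiece I (j - 1) else ⊥),
      f = quotIncl I (quotRetr I hI f) + Ideal.Quotient.mk I (X (Fin.last n)) * e := by
  obtain ⟨p, hp, rfl⟩ := mem_quotPiece.1 hf
  obtain ⟨q, hq⟩ := X_last_dvd_sub_rename_evalLast p
  have hh : (X (Fin.last n) * q).IsHomogeneous j := by
    rw [← hq]
    exact hp.sub (evalLast_isHomogeneous hp).rename_isHomogeneous
  -- Every power-product of `q` has degree one less than `j`; in particular `q = 0` when `j = 0`,
  -- where `j - 1` would be truncated.
  have hc : ∀ t, coeff t q ≠ 0 → Finsupp.weight 1 t + 1 = j := by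
    intro t ht
    rw [← coeff_X_mul t (Fin.last n) q] at ht
    have := hh ht
    rw [map_add, Finsupp.weight_single] at this
    simp only [Pi.one_apply, smul_eq_mul, mul_one] at this
    omega
  refine ⟨Ideal.Quotient.mk I q, ?_, ?_⟩
  · split_ifs with h
    · refine ⟨q, ?_, rfl⟩
      rw [SetLike.mem_coe, mem_homogeneousSubmodule]
      intro t ht
      have := hc t ht
      omega
    · have : q = 0 := by
        ext t
        by_contra ht
        have := hc t (by simpa using ht)
        omega
      simp [this]
  · rw [quotRetr_mk, quotIncl_mk, ← map_mul, ← hq, map_sub]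
    ring

instance finite_quotPiece {l : ℕ} (I : Ideal (MvPolynomial (Fin l) K)) (j : ℕ) :
    Module.Finite K (quotPiece I j) :=
  Module.Finite.iff_fg.2 ((homogeneousSubmodule_fg _ _ j).map _)

end Quotients

/-! ### The kernel of the multiplication by the last variable -/

section LastKernel

variable {K : Type*} [Field K] {n : ℕ} {I : Ideal (MvPolynomial (Fin (n + 1)) K)}

/-- The elements of `(S/I)_j` that are killed by the last variable. -/
def lastKernel (I : Ideal (MvPolynomial (Fin (n + 1)) K)) (j : ℕ) :
    Submodule K (MvPolynomial (Fin (n + 1)) K ⧸ I) :=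
  quotPiece I j ⊓ LinearMap.ker (LinearMap.mulLeft K (Ideal.Quotient.mk I (X (Fin.last n))))

theorem mem_lastKernel {j : ℕ} {f : MvPolynomial (Fin (n + 1)) K ⧸ I} :
    f ∈ lastKernel I j ↔ f ∈ quotPiece I j ∧ Ideal.Quotient.mk I (X (Fin.last n)) * f = 0 :=
  Iff.rfl

instance finite_lastKernel (I : Ideal (MvPolynomial (Fin (n + 1)) K)) (j : ℕ) :
    Module.Finite K (lastKernel I j) :=
  Submodule.finiteDimensional_of_le inf_le_left

theorem IsStronglyStable.X_mul_eq_zero (hI : IsStronglyStable I)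
    {f : MvPolynomial (Fin (n + 1)) K ⧸ I} (hf : Ideal.Quotient.mk I (X (Fin.last n)) * f = 0)
    (k : Fin (n + 1)) : Ideal.Quotient.mk I (X k) * f = 0 := by
  obtain ⟨p, rfl⟩ := Ideal.Quotient.mk_surjective f
  rw [← map_mul, Ideal.Quotient.eq_zero_iff_mem] at hf ⊢
  exact hI.X_mul_mem hf k

/-- The variables span the linear forms. -/
theorem IsStronglyStable.linear_mul_eq_zero (hI : IsStronglyStable I)
    {f a : MvPolynomial (Fin (n + 1)) K ⧸ I}
    (hf : Ideal.Quotient.mk I (X (Fin.last n)) * f = 0) (ha : a ∈ quotPiece I 1) : a * f = 0 := by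
  have : quotPiece I 1 ≤ LinearMap.ker (LinearMap.mulRight K f) := by
    rw [quotPiece, homogeneousSubmodule_one_eq_span_X, Submodule.map_span, Submodule.span_le]
    rintro _ ⟨_, ⟨k, rfl⟩, rfl⟩
    exact hI.X_mul_eq_zero hf k
  exact this ha

theorem mul_mem_quotPiece {l : ℕ} {I : Ideal (MvPolynomial (Fin l) K)} {i j : ℕ}
    {a f : MvPolynomial (Fin l) K ⧸ I} (ha : a ∈ quotPiece I i) (hf : f ∈ quotPiece I j) :
    a * f ∈ quotPiece I (j + i) := by
  obtain ⟨p, hp, rfl⟩ := mem_quotPiece.1 hf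
  obtain ⟨q, hq, rfl⟩ := mem_quotPiece.1 ha
  exact ⟨q * p, by rw [add_comm]; exact hq.mul hp, map_mul (Ideal.Quotient.mk I) _ _⟩

theorem X_mem_quotPiece {l : ℕ} (I : Ideal (MvPolynomial (Fin l) K)) (k : Fin l) :
    Ideal.Quotient.mk I (X k) ∈ quotPiece I 1 :=
  ⟨X k, isHomogeneous_X K k, rfl⟩

/-- Multiplication `(S/I)_j → (S/I)_{j+1}` by an element of degree one. -/
def mulPiece {l : ℕ} (I : Ideal (MvPolynomial (Fin l) K)) (j : ℕ)
    (a : MvPolynomial (Fin l) K ⧸ I) (ha : a ∈ quotPiece I 1) :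
    quotPiece I j →ₗ[K] quotPiece I (j + 1) :=
  (LinearMap.mulLeft K a).restrict fun _ hf => mul_mem_quotPiece ha hf

theorem finrank_lastKernel_eq (j : ℕ) : Module.finrank K (lastKernel I j) =
    Module.finrank K (LinearMap.ker (mulPiece I j _ (X_mem_quotPiece I (Fin.last n)))) := by
  have : lastKernel I j =
      (LinearMap.ker (mulPiece I j _ (X_mem_quotPiece I (Fin.last n)))).map
        (quotPiece I j).subtype := by
    ext f
    constructor
    · rintro ⟨hf, h⟩
      exact ⟨⟨f, hf⟩, Subtype.ext h, rfl⟩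
    · rintro ⟨⟨g, hg⟩, h, rfl⟩
      exact ⟨hg, congrArg Subtype.val h⟩
  rw [this]
  exact Submodule.finrank_map_subtype_eq _ _

/-- If `S/I` has the weak Lefschetz property, then the last variable is a Lefschetz element. -/
theorem finrank_lastKernel (hI : IsStronglyStable I) (hWLP : HasWLP (quotPiece I)) (j : ℕ) :
    (Module.finrank K (lastKernel I j) : ℤ) = cDiff I (j + 1) := by
  obtain ⟨a, ha, h⟩ := hWLP
  have hx := LinearMap.finrank_range_add_finrank_ker
    (mulPiece I j _ (X_mem_quotPiece I (Fin.last n)))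
  have hx' := Submodule.finrank_le
    (LinearMap.range (mulPiece I j _ (X_mem_quotPiece I (Fin.last n))))
  have hle : LinearMap.ker (mulPiece I j _ (X_mem_quotPiece I (Fin.last n))) ≤
      LinearMap.ker (mulPiece I j a ha) := by
    intro f hf
    have hf' := congrArg Subtype.val (LinearMap.mem_ker.1 hf)
    exact LinearMap.mem_ker.2 (Subtype.ext (hI.linear_mul_eq_zero hf' ha))
  have hle' := Submodule.finrank_mono hle
  rw [← finrank_lastKernel_eq] at hx hle'
  have ha' := LinearMap.finrank_range_add_finrank_ker (mulPiece I j a ha)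
  rw [cDiff, hilbertFn, hilbertFn]
  rcases h j with h | h
  -- If `a` is injective, so is the last variable; hence the Hilbert function does not drop and the
  -- maximum is `0`.
  · have : LinearMap.ker (mulPiece I j a ha) = ⊥ :=
      LinearMap.ker_eq_bot'.2 fun f hf =>
        Subtype.ext (h f f.2 (congrArg Subtype.val hf))
    rw [this, finrank_bot] at hle'
    omega
  -- If `a` is surjective, its kernel has dimension `HF(j) - HF(j + 1)`, an upper bound for the
  -- kernel of the last variable; rank-nullity for the last variable gives the same lower bound.
  · have : LinearMap.range (mulPiece I j a ha) = ⊤ :=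
      LinearMap.range_eq_top.2 fun g => by
        obtain ⟨f, hf, hfg⟩ := h g g.2
        exact ⟨⟨f, hf⟩, Subtype.ext hfg⟩
    rw [this, finrank_top] at ha'
    omega

end LastKernel

/-! ### The Koszul complex over one variable less -/

section Split

variable {n : ℕ}

/-- The chains on the subsets of `Fin (n + 1)` given by their values on the sets without and the
sets with the last element. -/
def glue {M : Type*} (a b : Finset (Fin n) → M) (t : Finset (Fin (n + 1))) : M :=
  if Fin.last n ∈ t then b (Finset.univ.filter fun k => k.castSucc ∈ t)
  else a (Finset.univ.filter fun k => k.castSucc ∈ t)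

/-- A subset of `Fin n` as a subset of `Fin (n + 1)`. -/
def lift (s : Finset (Fin n)) : Finset (Fin (n + 1)) := s.map Fin.castSuccEmb

/-- A subset of `Fin n` together with the last element of `Fin (n + 1)`. -/
def liftLast (s : Finset (Fin n)) : Finset (Fin (n + 1)) := insert (Fin.last n) (lift s)

theorem last_notMem_lift (s : Finset (Fin n)) : Fin.last n ∉ lift s := by
  simp [lift, Fin.castSucc_ne_last]

@[simp] theorem castSucc_mem_lift {s : Finset (Fin n)} {k : Fin n} :
    k.castSucc ∈ lift s ↔ k ∈ s := by
  simp [lift]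

@[simp] theorem castSucc_mem_liftLast {s : Finset (Fin n)} {k : Fin n} :
    k.castSucc ∈ liftLast s ↔ k ∈ s := by
  simp [liftLast, Fin.castSucc_ne_last]

@[simp] theorem card_lift (s : Finset (Fin n)) : (lift s).card = s.card := Finset.card_map _

@[simp] theorem card_liftLast (s : Finset (Fin n)) : (liftLast s).card = s.card + 1 := by
  rw [liftLast, Finset.card_insert_of_notMem (last_notMem_lift s), card_lift]

theorem insert_lift (k : Fin n) (s : Finset (Fin n)) :
    insert k.castSucc (lift s) = lift (insert k s) := by
  simp [lift, Finset.map_insert]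

theorem insert_liftLast (k : Fin n) (s : Finset (Fin n)) :
    insert k.castSucc (liftLast s) = liftLast (insert k s) := by
  rw [liftLast, Finset.insert_comm, insert_lift, liftLast]

theorem compl_lift (s : Finset (Fin n)) : (lift s)ᶜ = liftLast sᶜ := by
  ext k
  induction k using Fin.lastCases with
  | last => simp [liftLast, last_notMem_lift]
  | cast k => simp

theorem compl_liftLast (s : Finset (Fin n)) : (liftLast s)ᶜ = lift sᶜ := by
  ext k
  induction k using Fin.lastCases with
  | last => simp [liftLast, last_notMem_lift]
  | cast k => simp

theorem card_filter_lift_lt (s : Finset (Fin n)) (k : Fin n) :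
    ((lift s).filter (· < k.castSucc)).card = (s.filter (· < k)).card := by
  rw [lift, Finset.filter_map, Finset.card_map]
  rfl

theorem card_filter_liftLast_lt (s : Finset (Fin n)) (k : Fin n) :
    ((liftLast s).filter (· < k.castSucc)).card = (s.filter (· < k)).card := by
  rw [liftLast, Finset.filter_insert, if_neg (Fin.castSucc_lt_last k).not_gt, card_filter_lift_lt]

theorem card_filter_lift_lt_last (s : Finset (Fin n)) :
    ((lift s).filter (· < Fin.last n)).card = s.card := by
  rw [lift, Finset.filter_map, Finset.card_map, Finset.filter_true_of_mem]
  intro k _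
  exact Fin.castSucc_lt_last k

theorem exists_lift (t : Finset (Fin (n + 1))) : ∃ s, t = lift s ∨ t = liftLast s := by
  refine ⟨Finset.univ.filter fun k => k.castSucc ∈ t, ?_⟩
  by_cases h : Fin.last n ∈ t
  · right
    ext k
    induction k using Fin.lastCases with
    | last => simp [liftLast, h]
    | cast k => simp
  · left
    ext k
    induction k using Fin.lastCases with
    | last => simp [last_notMem_lift, h]
    | cast k => simp

variable {M : Type*}

@[simp] theorem glue_lift (a b : Finset (Fin n) → M) (s : Finset (Fin n)) :
    glue a b (lift s) = a s := by
  simp [glue, last_notMem_lift]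

@[simp] theorem glue_liftLast (a b : Finset (Fin n) → M) (s : Finset (Fin n)) :
    glue a b (liftLast s) = b s := by
  have : Fin.last n ∈ liftLast s := Finset.mem_insert_self _ _
  simp [glue, this]

theorem funext_lift {c c' : Finset (Fin (n + 1)) → M} (h : ∀ s, c (lift s) = c' (lift s))
    (h' : ∀ s, c (liftLast s) = c' (liftLast s)) : c = c' := by
  funext t
  obtain ⟨s, rfl | rfl⟩ := exists_lift t
  exacts [h s, h' s]

end Split

/-- The Koszul differential of a sequence of elements of a ring. -/
def ringKoszulD {R : Type*} [CommRing R] {n : ℕ} (y : Fin n → R) (c : Finset (Fin n) → R)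
    (s : Finset (Fin n)) : R :=
  ∑ k ∈ sᶜ, (-1) ^ (s.filter (· < k)).card * y k * c (insert k s)

section RingKoszulD

variable {R : Type*} [CommRing R] {n : ℕ} (y : Fin n → R)

theorem map_ringKoszulD {R' : Type*} [CommRing R'] (φ : R →+* R') (c : Finset (Fin n) → R)
    (s : Finset (Fin n)) :
    φ (ringKoszulD y c s) = ringKoszulD (fun k => φ (y k)) (fun s => φ (c s)) s := by
  simp [ringKoszulD]

theorem ringKoszulD_eq_zero {c : Finset (Fin n) → R} (h : ∀ k s, y k * c s = 0)
    (s : Finset (Fin n)) : ringKoszulD y c s = 0 :=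
  Finset.sum_eq_zero fun k _ => by rw [mul_assoc, h, mul_zero]

variable {K : Type*} [Field K]

theorem koszulD_quotient (I : Ideal (MvPolynomial (Fin n) K))
    (c : Finset (Fin n) → MvPolynomial (Fin n) K ⧸ I) :
    koszulD K _ c = ringKoszulD (fun k => Ideal.Quotient.mk I (X k)) c := by
  funext s
  refine Finset.sum_congr rfl fun k _ => ?_
  refine (Algebra.smul_def (A := MvPolynomial (Fin n) K ⧸ I) _ _).trans ?_
  rw [koszulCoeff, Ideal.Quotient.algebraMap_eq]
  simp

variable (I : Ideal (MvPolynomial (Fin (n + 1)) K))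
  (c : Finset (Fin (n + 1)) → MvPolynomial (Fin (n + 1)) K ⧸ I) (s : Finset (Fin n))

/-- The last index exceeds all elements of `s`, whence the sign `(-1) ^ s.card`; for the other
indices the signs are those of the complex in `n` variables. With `koszulD_liftLast` this is the
mapping cone description. -/
theorem koszulD_lift :
    koszulD K _ c (lift s) =
      ringKoszulD (fun k => Ideal.Quotient.mk I (X k.castSucc)) (fun s => c (lift s)) s +
        (-1) ^ s.card * Ideal.Quotient.mk I (X (Fin.last n)) * c (liftLast s) := by
  rw [koszulD_quotient, ringKoszulD, compl_lift, liftLast,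
    Finset.sum_insert (last_notMem_lift _), card_filter_lift_lt_last, ← liftLast]
  refine (add_comm _ _).trans (congrArg₂ _ ?_ rfl)
  rw [lift, Finset.sum_map]
  refine Finset.sum_congr rfl fun k _ => ?_
  rw [Fin.castSuccEmb_apply, card_filter_lift_lt, insert_lift]

theorem koszulD_liftLast :
    koszulD K _ c (liftLast s) =
      ringKoszulD (fun k => Ideal.Quotient.mk I (X k.castSucc)) (fun s => c (liftLast s)) s := by
  rw [koszulD_quotient, ringKoszulD, compl_liftLast, lift, Finset.sum_map]
  refine Finset.sum_congr rfl fun k _ => ?_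
  rw [Fin.castSuccEmb_apply, card_filter_liftLast_lt, insert_liftLast]

end RingKoszulD

/-! ### The homology of the Koszul complex with coefficients in `S/I` -/

section Comparison

variable {K : Type*} [Field K] {n : ℕ}

theorem mem_koszulPiece_add {l : ℕ} {M : Type*} [AddCommGroup M] [Module K M]
    {𝓜 : ℕ → Submodule K M} {i j : ℕ} {c : Finset (Fin l) → M} :
    c ∈ koszulPiece 𝓜 i (i + j) ↔ ∀ s, c s ∈ if s.card = i then 𝓜 j else ⊥ := by
  simp [koszulPiece, Submodule.mem_pi]

theorem mem_koszulPiece_succ_add {l : ℕ} {M : Type*} [AddCommGroup M] [Module K M]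
    {𝓜 : ℕ → Submodule K M} {i j : ℕ} {c : Finset (Fin l) → M} :
    c ∈ koszulPiece 𝓜 (i + 1) (i + j) ↔
      ∀ s, c s ∈ if s.card = i + 1 ∧ 1 ≤ j then 𝓜 (j - 1) else ⊥ := by
  simp [koszulPiece, Submodule.mem_pi, Nat.add_sub_add_left]

instance finite_koszulPiece {l : ℕ} (I : Ideal (MvPolynomial (Fin l) K)) (i d : ℕ) :
    Module.Finite K (koszulPiece (l := l) (quotPiece I) i d) := by
  refine Submodule.finiteDimensional_of_le (S₂ := LinearMap.range
    ((quotPiece I (d - i)).subtype.compLeft (Finset (Fin l)))) fun c hc => ?_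
  have h : ∀ s, c s ∈ quotPiece I (d - i) := fun s => by
    have := (Submodule.mem_pi.1 hc) s trivial
    split_ifs at this
    · exact this
    · rw [(Submodule.mem_bot K).1 this]
      exact zero_mem _
  exact ⟨fun s => ⟨c s, h s⟩, rfl⟩

instance finite_koszulCycles {l : ℕ} (I : Ideal (MvPolynomial (Fin l) K)) (i d : ℕ) :
    Module.Finite K (koszulCycles (l := l) (quotPiece I) i d) :=
  Submodule.finiteDimensional_of_le inf_le_left

variable (I : Ideal (MvPolynomial (Fin (n + 1)) K))

theorem IsStronglyStable.isMonomialIdeal {l : ℕ} {I : Ideal (MvPolynomial (Fin l) K)}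
    (hI : IsStronglyStable I) : IsMonomialIdeal I :=
  hI.1

/-- The chains of `S/I` given by a chain of `S̄/Ī` and a family of elements of `S/I` killed by the
last variable. -/
def chainIncl (i j : ℕ) :
    (Finset (Fin n) → MvPolynomial (Fin n) K ⧸ contractLast I) ×
      ({s : Finset (Fin n) // s.card + 1 = i} → lastKernel I j) →ₗ[K]
    (Finset (Fin (n + 1)) → MvPolynomial (Fin (n + 1)) K ⧸ I) where
  toFun p := glue (fun s => quotIncl I (p.1 s))
    (fun s => if h : s.card + 1 = i then (p.2 ⟨s, h⟩ : MvPolynomial (Fin (n + 1)) K ⧸ I) else 0)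
  map_add' p q := funext_lift (fun s => by simp) (fun s => by
    simp only [glue_liftLast, Pi.add_apply]
    split_ifs <;> simp)
  map_smul' r p := funext_lift (fun s => by simp) (fun s => by
    simp only [glue_liftLast, Pi.smul_apply]
    split_ifs <;> simp)

variable {I} {i j : ℕ} {a : Finset (Fin n) → MvPolynomial (Fin n) K ⧸ contractLast I}
  {b : {s : Finset (Fin n) // s.card + 1 = i} → lastKernel I j}

@[simp] theorem chainIncl_lift (s : Finset (Fin n)) :
    chainIncl I i j (a, b) (lift s) = quotIncl I (a s) :=
  glue_lift (fun s => quotIncl I (a s)) (fun s => if h : s.card + 1 = i then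
    (b ⟨s, h⟩ : MvPolynomial (Fin (n + 1)) K ⧸ I) else 0) s

@[simp] theorem chainIncl_liftLast (s : Finset (Fin n)) :
    chainIncl I i j (a, b) (liftLast s) = if h : s.card + 1 = i then
      (b ⟨s, h⟩ : MvPolynomial (Fin (n + 1)) K ⧸ I) else 0 :=
  glue_liftLast (fun s => quotIncl I (a s)) (fun s => if h : s.card + 1 = i then
    (b ⟨s, h⟩ : MvPolynomial (Fin (n + 1)) K ⧸ I) else 0) s

theorem quotRetr_mk_X_last_mul (hI : IsMonomialIdeal I) (f : MvPolynomial (Fin (n + 1)) K ⧸ I) :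
    quotRetr I hI (Ideal.Quotient.mk I (X (Fin.last n)) * f) = 0 := by
  simp

theorem ringKoszulD_quotIncl (a : Finset (Fin n) → MvPolynomial (Fin n) K ⧸ contractLast I)
    (s : Finset (Fin n)) :
    ringKoszulD (fun k => Ideal.Quotient.mk I (X k.castSucc)) (fun s => quotIncl I (a s)) s = quotIncl I (koszulD K _ a s) := by
  rw [koszulD_quotient]
  refine Eq.trans ?_ (map_ringKoszulD _ (quotIncl I).toRingHom a s).symm
  simp

theorem quotRetr_ringKoszulD (hI : IsMonomialIdeal I)
    (c : Finset (Fin n) → MvPolynomial (Fin (n + 1)) K ⧸ I) (s : Finset (Fin n)) :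
    quotRetr I hI (ringKoszulD (fun k => Ideal.Quotient.mk I (X k.castSucc)) c s) = koszulD K _ (fun s => quotRetr I hI (c s)) s := by
  rw [koszulD_quotient]
  refine (map_ringKoszulD _ (quotRetr I hI).toRingHom c s).trans ?_
  simp

/-- The differential multiplies the values of `b` by variables only, and all of these kill them. -/
theorem chainIncl_mem_koszulCycles (hI : IsStronglyStable I)
    (ha : a ∈ koszulCycles (quotPiece (contractLast I)) i (i + j)) :
    chainIncl I i j (a, b) ∈ koszulCycles (quotPiece I) i (i + j) := by
  obtain ⟨ha, ha'⟩ := ha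
  rw [SetLike.mem_coe, mem_koszulPiece_add] at ha
  rw [SetLike.mem_coe, LinearMap.mem_ker] at ha'
  refine ⟨mem_koszulPiece_add.2 fun t => ?_, LinearMap.mem_ker.2 (funext_lift ?_ ?_)⟩
  · obtain ⟨s, rfl | rfl⟩ := exists_lift t
    · have := ha s
      rw [chainIncl_lift, card_lift]
      split_ifs at this ⊢ with h
      · exact quotIncl_mem_quotPiece this
      · rw [(Submodule.mem_bot K).1 this, map_zero]
        exact zero_mem _
    · rw [chainIncl_liftLast, card_liftLast]
      split_ifs with h
      · exact (b ⟨s, h⟩).2.1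
      · exact zero_mem _
  · intro s
    rw [koszulD_lift]
    simp only [chainIncl_lift, chainIncl_liftLast]
    rw [ringKoszulD_quotIncl, ha']
    split_ifs with h
    · rw [mul_assoc, (mem_lastKernel.1 (b ⟨s, h⟩).2).2]
      simp
    · simp
  · intro s
    rw [koszulD_liftLast]
    refine ringKoszulD_eq_zero _ (fun k s => ?_) s
    rw [chainIncl_liftLast]
    split_ifs with h
    · exact hI.X_mul_eq_zero (b ⟨s, h⟩).2.2 _
    · rw [mul_zero]

theorem chainIncl_mem_koszulBoundaries
    (ha : a ∈ koszulBoundaries (quotPiece (contractLast I)) i (i + j)) :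
    chainIncl I i j (a, 0) ∈ koszulBoundaries (quotPiece I) i (i + j) := by
  obtain ⟨a, ha, rfl⟩ := ha
  rw [SetLike.mem_coe, mem_koszulPiece_succ_add] at ha
  refine ⟨glue (fun s => quotIncl I (a s)) 0, mem_koszulPiece_succ_add.2 fun t => ?_,
    funext_lift (fun s => ?_) fun s => ?_⟩
  · obtain ⟨s, rfl | rfl⟩ := exists_lift t
    · have := ha s
      rw [glue_lift, card_lift]
      split_ifs at this ⊢ with h
      · exact quotIncl_mem_quotPiece this
      · rw [(Submodule.mem_bot K).1 this, map_zero]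
        exact zero_mem _
    · rw [glue_liftLast]
      exact zero_mem _
  · rw [koszulD_lift]
    simp only [glue_lift, glue_liftLast, chainIncl_lift]
    rw [ringKoszulD_quotIncl]
    simp
  · rw [koszulD_liftLast]
    simp only [glue_liftLast, chainIncl_liftLast]
    rw [ringKoszulD_eq_zero _ (by simp)]
    simp

/-- The chain whose boundary has the value `x_l * e s` on every set `s` without the last element. -/
def lastLift (e : Finset (Fin n) → MvPolynomial (Fin (n + 1)) K ⧸ I) :
    Finset (Fin (n + 1)) → MvPolynomial (Fin (n + 1)) K ⧸ I :=
  glue 0 fun s => (-1) ^ s.card * e s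

theorem koszulD_lastLift (e : Finset (Fin n) → MvPolynomial (Fin (n + 1)) K ⧸ I)
    (s : Finset (Fin n)) :
    koszulD K _ (lastLift e) (lift s) = Ideal.Quotient.mk I (X (Fin.last n)) * e s := by
  rw [koszulD_lift, lastLift]
  simp only [glue_lift, glue_liftLast]
  rw [ringKoszulD_eq_zero _ (by simp), zero_add]
  rcases neg_one_pow_eq_or (MvPolynomial (Fin (n + 1)) K ⧸ I) s.card with h | h <;> rw [h] <;> ring

/-- Surjectivity on homology: the boundary of `lastLift e` removes the multiples of `x_l` from the
values on sets without the last index. -/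
theorem exists_sub_chainIncl_mem_koszulBoundaries (hI : IsStronglyStable I)
    {c : Finset (Fin (n + 1)) → MvPolynomial (Fin (n + 1)) K ⧸ I}
    (hc : c ∈ koszulCycles (quotPiece I) i (i + j)) :
    ∃ a ∈ koszulCycles (quotPiece (contractLast I)) i (i + j),
      ∃ b : {s : Finset (Fin n) // s.card + 1 = i} → lastKernel I j,
        c - chainIncl I i j (a, b) ∈ koszulBoundaries (quotPiece I) i (i + j) := by
  have hc0 := mem_koszulPiece_add.1 hc.1
  have hdec : ∀ s : Finset (Fin n), ∃ e : MvPolynomial (Fin (n + 1)) K ⧸ I,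
      (e ∈ if s.card = i ∧ 1 ≤ j then quotPiece I (j - 1) else ⊥) ∧
      c (lift s) = quotIncl I (quotRetr I hI.isMonomialIdeal (c (lift s))) +
        Ideal.Quotient.mk I (X (Fin.last n)) * e := by
    intro s
    have := hc0 (lift s)
    rw [card_lift] at this
    by_cases h : s.card = i
    · rw [if_pos h] at this
      simpa [h] using exists_eq_quotIncl_quotRetr_add hI.isMonomialIdeal this
    · rw [if_neg h, Submodule.mem_bot] at this
      exact ⟨0, zero_mem _, by simp [this]⟩
  choose e he hce using hdec
  set E := lastLift e with hE
  have hEp : E ∈ koszulPiece (quotPiece I) (i + 1) (i + j) := by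
    refine mem_koszulPiece_succ_add.2 fun t => ?_
    obtain ⟨s, rfl | rfl⟩ := exists_lift t
    · rw [hE, lastLift, glue_lift]
      exact zero_mem _
    · rw [hE, lastLift, glue_liftLast, card_liftLast]
      simp only [Nat.add_right_cancel_iff]
      rcases neg_one_pow_eq_or (MvPolynomial (Fin (n + 1)) K ⧸ I) s.card with h | h <;> rw [h]
      · simpa using he s
      · simpa using he s
  have hEb : koszulD K _ E ∈ koszulBoundaries (quotPiece I) i (i + j) := ⟨E, hEp, rfl⟩
  have hc' : c - koszulD K _ E ∈ koszulCycles (quotPiece I) i (i + j) :=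
    sub_mem hc (koszulBoundaries_le_koszulCycles _
      (fun k j f hf => by
        have := X_mul_mem_quotPiece k hf
        rwa [← Ideal.Quotient.algebraMap_eq, ← Algebra.smul_def] at this) _ _ hEb)
  set c' := c - koszulD K _ E with hc'd
  have hlift : ∀ s, c' (lift s) = quotIncl I (quotRetr I hI.isMonomialIdeal (c (lift s))) := by
    intro s
    rw [hc'd, Pi.sub_apply, hE, koszulD_lastLift, sub_eq_iff_eq_add]
    exact hce s
  have hc'0 := mem_koszulPiece_add.1 hc'.1
  have hD : ∀ s, quotIncl I (koszulD K _ (fun s => quotRetr I hI.isMonomialIdeal (c (lift s))) s) +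
      (-1) ^ s.card * Ideal.Quotient.mk I (X (Fin.last n)) * c' (liftLast s) = 0 := by
    intro s
    have h := congrFun (LinearMap.mem_ker.1 hc'.2) (lift s)
    rw [koszulD_lift] at h
    simp only [hlift] at h
    rwa [ringKoszulD_quotIncl] at h
  -- The two summands of `hD` lie in the complementary spaces `S̄/Ī` and `x_l (S/I)`; the retraction
  -- isolates the first.
  have ha : ∀ s, koszulD K _ (fun s => quotRetr I hI.isMonomialIdeal (c (lift s))) s = 0 := by
    intro s
    have h := congrArg (quotRetr I hI.isMonomialIdeal) (hD s)
    rwa [map_add, quotRetr_quotIncl, mul_assoc, map_mul, quotRetr_mk_X_last_mul, mul_zero,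
      add_zero, map_zero] at h
  have hb : ∀ s, Ideal.Quotient.mk I (X (Fin.last n)) * c' (liftLast s) = 0 := by
    intro s
    have h := hD s
    rw [ha, map_zero, zero_add, mul_assoc] at h
    rcases neg_one_pow_eq_or (MvPolynomial (Fin (n + 1)) K ⧸ I) s.card with h' | h' <;>
      simpa [h'] using h
  refine ⟨fun s => quotRetr I hI.isMonomialIdeal (c (lift s)), ⟨mem_koszulPiece_add.2 fun s => ?_,
    LinearMap.mem_ker.2 (funext ha)⟩, fun s => ⟨c' (liftLast s), ?_, hb s⟩, ?_⟩
  · have := hc0 (lift s)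
    rw [card_lift] at this
    split_ifs at this ⊢
    · exact quotRetr_mem_quotPiece hI.isMonomialIdeal this
    · rw [(Submodule.mem_bot K).1 this, map_zero]
      exact zero_mem _
  · have := hc'0 (liftLast s)
    rwa [card_liftLast, if_pos s.2] at this
  -- The corrected cycle `c'` equals the chain built from `a` and `b`, so the difference is exactly
  -- the boundary of `E`.
  · convert hEb using 1
    rw [sub_eq_iff_eq_add', ← sub_eq_iff_eq_add, ← hc'd]
    refine funext_lift (fun s => ?_) fun s => ?_
    · rw [chainIncl_lift, hlift]
    · rw [chainIncl_liftLast]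
      by_cases h : s.card + 1 = i
      · rw [dif_pos h]
      · rw [dif_neg h]
        have := hc'0 (liftLast s)
        rwa [card_liftLast, if_neg h, Submodule.mem_bot] at this

/-- Injectivity on homology: the retraction turns a chain bounding `(a, b)` into one bounding `a`.
After normalisation its values on sets with the last index are killed by `x_l`, hence by all
variables, so they contribute nothing to `b`. -/
theorem of_chainIncl_mem_koszulBoundaries (hI : IsStronglyStable I)
    (h : chainIncl I i j (a, b) ∈ koszulBoundaries (quotPiece I) i (i + j)) :
    a ∈ koszulBoundaries (quotPiece (contractLast I)) i (i + j) ∧ b = 0 := by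
  obtain ⟨c, hc, hcd⟩ := h
  rw [SetLike.mem_coe, mem_koszulPiece_succ_add] at hc
  have hlift : ∀ s, ringKoszulD (fun k => Ideal.Quotient.mk I (X k.castSucc)) (fun s => c (lift s)) s +
      (-1) ^ s.card * Ideal.Quotient.mk I (X (Fin.last n)) * c (liftLast s) =
        quotIncl I (a s) := by
    intro s
    rw [← koszulD_lift, hcd, chainIncl_lift]
  have ha : koszulD K _ (fun s => quotRetr I hI.isMonomialIdeal (c (lift s))) = a := by
    funext s
    rw [← quotRetr_ringKoszulD hI.isMonomialIdeal, ← quotRetr_quotIncl hI.isMonomialIdeal (a s), ← hlift, map_add,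
      mul_assoc, map_mul _ ((-1) ^ _), quotRetr_mk_X_last_mul, mul_zero, add_zero]
  refine ⟨⟨_, mem_koszulPiece_succ_add.2 fun s => ?_, ha⟩, ?_⟩
  · have := hc (lift s)
    rw [card_lift] at this
    split_ifs at this ⊢
    · exact quotRetr_mem_quotPiece hI.isMonomialIdeal this
    · rw [(Submodule.mem_bot K).1 this, map_zero]
      exact zero_mem _
  have hdec : ∀ s : Finset (Fin n), ∃ e : MvPolynomial (Fin (n + 1)) K ⧸ I,
      c (lift s) = quotIncl I (quotRetr I hI.isMonomialIdeal (c (lift s))) +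
        Ideal.Quotient.mk I (X (Fin.last n)) * e := by
    intro s
    have := hc (lift s)
    split_ifs at this
    · obtain ⟨e, -, he⟩ := exists_eq_quotIncl_quotRetr_add hI.isMonomialIdeal this
      exact ⟨e, he⟩
    · rw [(Submodule.mem_bot K).1 this]
      exact ⟨0, by simp⟩
  choose e he using hdec
  -- Subtracting a boundary leaves the boundary of `c` unchanged and puts its values on sets without
  -- the last index into `S̄/Ī`.
  set c' := c - koszulD K _ (lastLift e) with hc'
  have hcd' : koszulD K _ c' = chainIncl I i j (a, b) := by
    rw [hc', map_sub, koszulD_koszulD, sub_zero, hcd]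
  have hlift' : ∀ s, c' (lift s) =
      quotIncl I (quotRetr I hI.isMonomialIdeal (c (lift s))) := by
    intro s
    rw [hc', Pi.sub_apply, koszulD_lastLift, sub_eq_iff_eq_add]
    exact he s
  have hb : ∀ s, Ideal.Quotient.mk I (X (Fin.last n)) * c' (liftLast s) = 0 := by
    intro s
    have h := congrFun hcd' (lift s)
    rw [koszulD_lift, chainIncl_lift] at h
    simp only [hlift'] at h
    rw [ringKoszulD_quotIncl, ha, mul_assoc, add_eq_left] at h
    rcases neg_one_pow_eq_or (MvPolynomial (Fin (n + 1)) K ⧸ I) s.card with h' | h' <;>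
      simpa [h'] using h
  funext s
  have h := congrFun hcd' (liftLast s)
  rw [koszulD_liftLast, chainIncl_liftLast, dif_pos s.2,
    ringKoszulD_eq_zero _ fun k s => hI.X_mul_eq_zero (hb s) _] at h
  exact Subtype.ext h.symm

end Comparison

/-! ### Dimension count for the graded Betti numbers -/

section Betti

variable {K : Type*} [Field K] {n : ℕ} {I : Ideal (MvPolynomial (Fin (n + 1)) K)}

/-- The map from the cycles of `S̄/Ī` and the elements killed by the last variable to the
cycles of `S/I`. -/
def cyclesIncl (hI : IsStronglyStable I) (i j : ℕ) :
    koszulCycles (l := n) (quotPiece (contractLast I)) i (i + j) ×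
      ({s : Finset (Fin n) // s.card + 1 = i} → lastKernel I j) →ₗ[K]
    koszulCycles (l := n + 1) (quotPiece I) i (i + j) :=
  ((chainIncl I i j) ∘ₗ ((Submodule.subtype _).prodMap LinearMap.id)).codRestrict _
    fun p => chainIncl_mem_koszulCycles hI p.1.2

theorem finrank_ker_mkQ_comp_cyclesIncl (hI : IsStronglyStable I) (i j : ℕ) :
    Module.finrank K (LinearMap.ker (((koszulBoundaries (quotPiece I) i (i + j)).submoduleOf
      (koszulCycles (l := n + 1) (quotPiece I) i (i + j))).mkQ ∘ₗ cyclesIncl hI i j)) =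
    Module.finrank K ((koszulBoundaries (quotPiece (contractLast I)) i (i + j)).submoduleOf
      (koszulCycles (l := n) (quotPiece (contractLast I)) i (i + j))) := by
  have : LinearMap.ker (((koszulBoundaries (quotPiece I) i (i + j)).submoduleOf
      (koszulCycles (l := n + 1) (quotPiece I) i (i + j))).mkQ ∘ₗ cyclesIncl hI i j) =
      ((koszulBoundaries (quotPiece (contractLast I)) i (i + j)).submoduleOf
        (koszulCycles (l := n) (quotPiece (contractLast I)) i (i + j))).map (LinearMap.inl K _ _) := by
    ext ⟨a, b⟩
    rw [LinearMap.mem_ker, LinearMap.comp_apply, Submodule.mkQ_apply,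
      Submodule.Quotient.mk_eq_zero]
    constructor
    · intro h
      obtain ⟨ha, rfl⟩ := of_chainIncl_mem_koszulBoundaries hI (a := a.1) (b := b) h
      exact ⟨a, ha, rfl⟩
    · rintro ⟨a', ha, h⟩
      obtain ⟨rfl, rfl⟩ := Prod.mk.inj h
      exact chainIncl_mem_koszulBoundaries ha
  rw [this]
  exact (Submodule.equivMapOfInjective _ LinearMap.inl_injective _).symm.finrank_eq

/-- Rank-nullity for the surjection from cycles of `S̄/Ī` and families in `lastKernel I j` onto the
Tor of `S/I`, whose kernel consists of the boundaries of `S̄/Ī`. -/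
theorem gradedBetti_eq (hI : IsStronglyStable I) (i j : ℕ) :
    gradedBetti I i (i + j) = gradedBetti (contractLast I) i (i + j) +
      Fintype.card {s : Finset (Fin n) // s.card + 1 = i} * Module.finrank K (lastKernel I j) := by
  have hsurj : Function.Surjective (((koszulBoundaries (quotPiece I) i (i + j)).submoduleOf
      (koszulCycles (l := n + 1) (quotPiece I) i (i + j))).mkQ ∘ₗ cyclesIncl hI i j) := by
    intro q
    obtain ⟨⟨c, hc⟩, rfl⟩ := Submodule.mkQ_surjective _ q
    obtain ⟨a, ha, b, h⟩ := exists_sub_chainIncl_mem_koszulBoundaries hI hc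
    refine ⟨(⟨a, ha⟩, b), Eq.symm ?_⟩
    rw [LinearMap.comp_apply, Submodule.mkQ_apply, Submodule.mkQ_apply, Submodule.Quotient.eq]
    exact h
  have h1 := LinearMap.finrank_range_add_finrank_ker
    (((koszulBoundaries (quotPiece I) i (i + j)).submoduleOf
      (koszulCycles (l := n + 1) (quotPiece I) i (i + j))).mkQ ∘ₗ cyclesIncl hI i j)
  rw [LinearMap.range_eq_top.2 hsurj, finrank_top, finrank_ker_mkQ_comp_cyclesIncl,
    Module.finrank_prod, Module.finrank_pi_fintype, Finset.sum_const, smul_eq_mul,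
    Finset.card_univ] at h1
  have h2 : gradedBetti (contractLast I) i (i + j) + _ = _ :=
    Submodule.finrank_quotient_add_finrank
      ((koszulBoundaries (quotPiece (contractLast I)) i (i + j)).submoduleOf
        (koszulCycles (l := n) (quotPiece (contractLast I)) i (i + j)))
  have h3 : gradedBetti I i (i + j) + _ = _ := h1
  omega

end Betti

end LefschetzBetti

end

theorem mainTheorem9 {K : Type*} [Field K] [CharZero K] (n : ℕ)
    (I : Ideal (MvPolynomial (Fin (n + 1)) K))
    (hI : LefschetzBetti.IsStronglyStable I)
    (hWLP : LefschetzBetti.HasWLP (LefschetzBetti.quotPiece I)) :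
    (∀ j : ℕ, LefschetzBetti.gradedBetti I 0 j =
      LefschetzBetti.gradedBetti (LefschetzBetti.contractLast I) 0 j) ∧
    (∀ i j : ℕ, 1 ≤ i →
      (LefschetzBetti.gradedBetti I i (i + j) : ℤ) =
        (LefschetzBetti.gradedBetti (LefschetzBetti.contractLast I) i (i + j) : ℤ) +
          (Nat.choose n (i - 1) : ℤ) * LefschetzBetti.cDiff I (j + 1)) := by
  -- Here `l = n + 1`. For `i = 0` no set satisfies `s.card + 1 = 0`, in accordance with `binom(l-1,
  -- -1) = 0`; the case is separate because the truncated `n.choose (0 - 1)` is `1`.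
  refine ⟨fun j => ?_, fun i j hi => ?_⟩
  · have h := LefschetzBetti.gradedBetti_eq hI 0 j
    simpa using h
  · obtain ⟨i, rfl⟩ := Nat.exists_eq_add_of_le' hi
    rw [LefschetzBetti.gradedBetti_eq hI, ← LefschetzBetti.finrank_lastKernel hI hWLP]
    have : Fintype.card {s : Finset (Fin n) // s.card + 1 = i + 1} = n.choose i := by
      simp only [Nat.add_right_cancel_iff]
      rw [Fintype.card_finset_len, Fintype.card_fin]
    rw [this]
    push_cast
    simp
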